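/- Let $X$ be a compact complex manifold (of finite dimension, Hausdorff) with a Hermitian metric $g$, i.e. a smooth Riemannian metric on $X$ with $g(Ju,Jv)=g(u,v)$ for the complex structure $J$. For a holomorphic map $f$ from an open subset of $\mathbb{C}$ (with coordinate $z=x+\sqrt{-1}\,y$) to $X$, put $|df|(z):=\sqrt2\,\bigl|df(\partial/\partial z)\bigr|$, where $\partial/\partial z=\frac12(\partial/\partial x-\sqrt{-1}\,\partial/\partial y)$ and where the norm on $TX\otimes_{\mathbb R}\mathbb{C}$ is $|w|=\sqrt{g(w,\bar w)}$, with $g$ extended complex bilinearly. Let $\mathcal{M}(X)$ be the set of holomorphic maps $f:\mathbb{C}\to X$ with $|df|(z)\le 1$ for all $z\in\mathbb{C}$, and define $$\rho(f):=\limsup_{R\to\infty}\frac{1}{\pi R^2}\int_{|z|\le R}|df|^2\,dx\,dy\quad(f\in\mathcal{M}(X)),\qquad \rho(X):=\sup_{f\in\mathcal{M}(X)}\rho(f)\in[0,1]$$ (with the supremum of the empty set read as $0$). For $r>0$ say that $X$ is $r$-WFL if there is no holomorphic isometric immersion of the disc $\Delta(r)=\{z\in\mathbb{C}:|z|<r\}$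 into $X$, that is, no holomorphic map $f:\Delta(r)\to X$ with $|df|(z)=1$ for all $z\in\Delta(r)$. If $X$ is $r$-WFL for some $r>0$, then $\rho(X)<1$. -/

import Mathlib

open scoped Manifold ContDiff
open Bundle MeasureTheory Filter

noncomputable section

namespace HolomorphicPacking

section RealStructure

variable {E : Type*} [NormedAddCommGroup E] [NormedSpace ℂ E]
  {X : Type*} [TopologicalSpace X] [ChartedSpace E X]

/-- The real manifold underlying a complex manifold (same charts, transition maps regarded as
real analytic maps). -/
instance isManifold_real [IsManifold 𝓘(ℂ, E) ω X] : IsManifold 𝓘(ℝ, E) ω X := by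
  refine isManifold_of_contDiffOn _ _ _ fun e e' he he' => ?_
  have h := (contDiffGroupoid ω 𝓘(ℂ, E)).compatible he he'
  rw [contDiffGroupoid, mem_groupoid_of_pregroupoid] at h
  exact ContDiffOn.restrict_scalars ℝ h.1

/-- The complex structure `J` on the real tangent space `T_x X`: multiplication by `i` in the
(holomorphic) coordinates at `x`. -/
def complexStructure (x : X) (u : TangentSpace 𝓘(ℝ, E) x) : TangentSpace 𝓘(ℝ, E) x :=
  (Complex.I • (show E from u) : E)

end RealStructure

/-- A Hermitian metric on a complex manifold `X`: a smooth Riemannian metric `g` on the underlying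
real manifold with `g (J u) (J v) = g u v`. -/
structure HermitianMetric (E : Type*) [NormedAddCommGroup E] [NormedSpace ℂ E]
    (X : Type*) [TopologicalSpace X] [ChartedSpace E X] [IsManifold 𝓘(ℂ, E) ω X]
    extends ContMDiffRiemannianMetric 𝓘(ℝ, E) ∞ E (fun x : X => TangentSpace 𝓘(ℝ, E) x) where
  compatible (x : X) (u v : TangentSpace 𝓘(ℝ, E) x) :
    inner x (complexStructure x u) (complexStructure x v) = inner x u v

section Curves

variable {E : Type*} [NormedAddCommGroup E] [NormedSpace ℂ E]
  {X : Type*} [TopologicalSpace X] [ChartedSpace E X] [IsManifold 𝓘(ℂ, E) ω X]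

/-- The norm `|w|` of the complexified tangent vector `w = u + √-1 v` in `T_x X ⊗ ℂ`, with
`u`, `v` real. If `g` is extended complex bilinearly, then
`|w| ^ 2 = g (w, conj w) = g (u, u) + g (v, v)`. -/
def HermitianMetric.complexNorm (g : HermitianMetric E X) (x : X)
    (u v : TangentSpace 𝓘(ℝ, E) x) : ℝ :=
  Real.sqrt (g.inner x u u + g.inner x v v)

/-- The partial derivative `df (∂/∂x)` at `z`. -/
def dfx (f : ℂ → X) (z : ℂ) : TangentSpace 𝓘(ℝ, E) (f z) :=
  mfderiv 𝓘(ℝ, ℂ) 𝓘(ℝ, E) f z (1 : ℂ)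

/-- The partial derivative `df (∂/∂y)` at `z`. -/
def dfy (f : ℂ → X) (z : ℂ) : TangentSpace 𝓘(ℝ, E) (f z) :=
  mfderiv 𝓘(ℝ, ℂ) 𝓘(ℝ, E) f z Complex.I

/-- `|df|(z) = √2 |df (∂/∂z)|`, where `∂/∂z = (1/2) (∂/∂x - √-1 ∂/∂y)`, so that `df (∂/∂z)` has
real part `(1/2) df (∂/∂x)` and imaginary part `-(1/2) df (∂/∂y)`. -/
def HermitianMetric.normDf (g : HermitianMetric E X) (f : ℂ → X) (z : ℂ) : ℝ :=
  Real.sqrt 2 * g.complexNorm (f z) ((1 / 2 : ℝ) • dfx f z) (-((1 / 2 : ℝ) • dfy f z))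

/-- The moduli space `M(X)` of holomorphic curves `f : ℂ → X` with `|df| ≤ 1`. -/
def HermitianMetric.moduli (g : HermitianMetric E X) : Set (ℂ → X) :=
  {f | MDifferentiable 𝓘(ℂ, ℂ) 𝓘(ℂ, E) f ∧ ∀ z, g.normDf f z ≤ 1}

/-- The packing density `ρ(f)`, the upper limit as `R → ∞` of
`(1 / (π R ^ 2)) ∫_{|z| ≤ R} |df| ^ 2 dx dy`, as an element of `[0, ∞]`. -/
def HermitianMetric.packingDensity (g : HermitianMetric E X) (f : ℂ → X) : ENNReal :=
  limsup (fun R : ℝ =>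
    (∫⁻ z in Metric.closedBall (0 : ℂ) R, ENNReal.ofReal (g.normDf f z ^ 2)) /
      ENNReal.ofReal (Real.pi * R ^ 2)) atTop

/-- The holomorphic capacity `ρ(X)`, the supremum of `ρ(f)` over `f ∈ M(X)`. -/
def HermitianMetric.holomorphicCapacity (g : HermitianMetric E X) : ENNReal :=
  ⨆ f ∈ g.moduli, g.packingDensity f

/-- `X` is `r`-WFL (without flat lines): no holomorphic map `f` from the open disc `Δ(r)` to `X`
satisfies `|df| = 1` on all of `Δ(r)`. A map on the disc is represented by an arbitrary extension
to `ℂ`; only its values on the disc matter. -/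
def HermitianMetric.IsWFL (g : HermitianMetric E X) (r : ℝ) : Prop :=
  ¬ ∃ f : ℂ → X, MDifferentiableOn 𝓘(ℂ, ℂ) 𝓘(ℂ, E) f (Metric.ball 0 r) ∧
    ∀ z ∈ Metric.ball (0 : ℂ) r, g.normDf f z = 1

end Curves

end HolomorphicPacking

end

open scoped Topology

namespace HolomorphicPacking

/-! ### Holomorphic curves in charts and in the tangent bundle. -/

section Calculus

variable {E : Type*} [NormedAddCommGroup E] [NormedSpace ℂ E]
  {X : Type*} [TopologicalSpace X] [ChartedSpace E X] [IsManifold 𝓘(ℂ, E) ω X]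

/-! The proof is a compactness argument followed by averaging. Curves with `|df| ≤ 1` are
equi-Lipschitz for the Riemannian distance, so by compactness of `X` any sequence of them has a
limit along an ultrafilter. By Weierstrass, applied in charts, the limit is holomorphic and `|df|`
converges as well (`exists_limit`). If the means of `|df|²` over `Δ(r)` came arbitrarily close to
`1`, the limit curve would satisfy `|df| = 1` on `Δ(r)`, which WFL forbids. Hence one `η < 1` bounds
these means for all curves at once (`exists_gap`).

The moduli space is invariant under translations of the plane, so the same `η` bounds the mean over
every disc of radius `r`. By Tonelli, the mean over a large disc is, up to a boundary layer of width
`r`, an average of means over such small discs (`limsup_div_le_of_setLIntegral_ball_le`). So `ρ(f) ≤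
η` for every `f`, and the uniformity of `η` keeps the supremum below `1`. -/

theorem differentiableAt_extChartAt_comp {f : ℂ → X} {z : ℂ} {p : X}
    (hf : MDifferentiableAt 𝓘(ℂ, ℂ) 𝓘(ℂ, E) f z) (hz : f z ∈ (chartAt E p).source) :
    DifferentiableAt ℂ (extChartAt 𝓘(ℂ, E) p ∘ f) z :=
  mdifferentiableAt_iff_differentiableAt.1
    ((mdifferentiableAt_iff_target_of_mem_source hz).1 hf).2

theorem mdifferentiableAt_real {f : ℂ → X} {z : ℂ}
    (hf : MDifferentiableAt 𝓘(ℂ, ℂ) 𝓘(ℂ, E) f z) :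
    MDifferentiableAt 𝓘(ℝ, ℂ) 𝓘(ℝ, E) f z := by
  have hz : f z ∈ (chartAt E (f z)).source := mem_chart_source E (f z)
  refine (mdifferentiableAt_iff_target_of_mem_source hz).2 ⟨hf.continuousAt, ?_⟩
  exact mdifferentiableAt_iff_differentiableAt.2
    ((differentiableAt_extChartAt_comp hf hz).restrictScalars ℝ)

theorem contMDiff_real [CompleteSpace E] {f : ℂ → X} (hf : MDifferentiable 𝓘(ℂ, ℂ) 𝓘(ℂ, E) f) :
    ContMDiff 𝓘(ℝ, ℂ) 𝓘(ℝ, E) 1 f := by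
  intro z
  have hz : f z ∈ (chartAt E (f z)).source := mem_chart_source E (f z)
  refine (contMDiffAt_iff_target_of_mem_source hz).2 ⟨hf.continuous.continuousAt, ?_⟩
  have ho : IsOpen (f ⁻¹' (chartAt E (f z)).source) :=
    (chartAt E (f z)).open_source.preimage hf.continuous
  have hd : DifferentiableOn ℂ (extChartAt 𝓘(ℂ, E) (f z) ∘ f) (f ⁻¹' (chartAt E (f z)).source) :=
    fun w hw => (differentiableAt_extChartAt_comp (hf w) hw).differentiableWithinAt
  exact (((hd.contDiffOn (n := 1) ho).contDiffAt (ho.mem_nhds hz)).restrict_scalars ℝ).contMDiffAt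

/-- A holomorphic curve in the coordinates of the tangent bundle at `p`. -/
theorem trivializationAt_mfderiv {f : ℂ → X} {z : ℂ} {p : X}
    (hf : MDifferentiableAt 𝓘(ℂ, ℂ) 𝓘(ℂ, E) f z) (hz : f z ∈ (chartAt E p).source) (v : ℂ) :
    (trivializationAt E (TangentSpace 𝓘(ℝ, E)) p
      (⟨f z, mfderiv 𝓘(ℝ, ℂ) 𝓘(ℝ, E) f z v⟩ : TangentBundle 𝓘(ℝ, E) X)).2 =
      v • deriv (extChartAt 𝓘(ℂ, E) p ∘ f) z := by
  have h1 := TangentBundle.continuousLinearMapAt_trivializationAt (I := 𝓘(ℝ, E)) hz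
  have h2 := mfderiv_comp z (mdifferentiableAt_extChartAt (I := 𝓘(ℝ, E)) hz)
    (mdifferentiableAt_real hf)
  have h3 : (trivializationAt E (TangentSpace 𝓘(ℝ, E)) p).continuousLinearMapAt ℝ (f z)
      (mfderiv 𝓘(ℝ, ℂ) 𝓘(ℝ, E) f z v) = v • deriv (extChartAt 𝓘(ℂ, E) p ∘ f) z := by
    rw [h1]
    have h4 := DFunLike.congr_fun h2 v
    refine h4.symm.trans ?_
    rw [mfderiv_eq_fderiv]
    have h5 := (differentiableAt_extChartAt_comp hf hz).hasDerivAt.hasFDerivAt.restrictScalars ℝ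
    rw [show fderiv ℝ (extChartAt 𝓘(ℝ, E) p ∘ f) z = _ from h5.fderiv]
    rfl
  rw [← h3, Trivialization.continuousLinearMapAt_apply, Trivialization.linearMapAt_apply, if_pos]
  exact hz

end Calculus

/-! ### The Riemannian distance and equicontinuity of the moduli space. -/

section Distance

variable {E : Type*} [NormedAddCommGroup E] [NormedSpace ℂ E]
  {X : Type*} [TopologicalSpace X] [ChartedSpace E X] [IsManifold 𝓘(ℂ, E) ω X]

theorem HermitianMetric.inner_self_nonneg (g : HermitianMetric E X) (x : X)
    (v : TangentSpace 𝓘(ℝ, E) x) : 0 ≤ g.inner x v v := by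
  by_cases hv : v = 0
  · simp [hv]
  · exact (g.pos x v hv).le

theorem HermitianMetric.normDf_sq (g : HermitianMetric E X) (f : ℂ → X) (z : ℂ) :
    g.normDf f z ^ 2 =
      (g.inner (f z) (dfx f z) (dfx f z) + g.inner (f z) (dfy f z) (dfy f z)) / 2 := by
  have h1 := g.inner_self_nonneg (f z) (dfx f z)
  have h2 := g.inner_self_nonneg (f z) (dfy f z)
  have h3 : g.complexNorm (f z) ((1 / 2 : ℝ) • dfx f z) (-((1 / 2 : ℝ) • dfy f z)) =
      Real.sqrt ((g.inner (f z) (dfx f z) (dfx f z) +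
        g.inner (f z) (dfy f z) (dfy f z)) / 4) := by
    unfold HermitianMetric.complexNorm
    congr 1
    simp only [map_smul, map_neg, smul_apply, neg_apply,
      smul_eq_mul]
    ring
  rw [HermitianMetric.normDf, h3, mul_pow, Real.sq_sqrt (by norm_num), Real.sq_sqrt (by positivity)]
  ring

theorem HermitianMetric.normDf_nonneg (g : HermitianMetric E X) (f : ℂ → X) (z : ℂ) :
    0 ≤ g.normDf f z :=
  mul_nonneg (Real.sqrt_nonneg _) (Real.sqrt_nonneg _)

theorem HermitianMetric.normDf_eq_sqrt (g : HermitianMetric E X) (f : ℂ → X) (z : ℂ) :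
    g.normDf f z = Real.sqrt
      ((g.inner (f z) (dfx f z) (dfx f z) + g.inner (f z) (dfy f z) (dfy f z)) / 2) := by
  rw [← g.normDf_sq, Real.sqrt_sq (g.normDf_nonneg f z)]

theorem HermitianMetric.continuous_inner_self (g : HermitianMetric E X) :
    Continuous fun v : TangentBundle 𝓘(ℝ, E) X => g.inner v.1 v.2 v.2 := by
  let : RiemannianBundle (fun x : X => TangentSpace 𝓘(ℝ, E) x) :=
    ⟨g.toContMDiffRiemannianMetric.toRiemannianMetric⟩
  have : IsContinuousRiemannianBundle E (fun x : X => TangentSpace 𝓘(ℝ, E) x) :=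
    ⟨g.inner, g.contMDiff.continuous, fun _ _ _ => rfl⟩
  exact Continuous.inner_bundle (F := E) (E := fun x : X => TangentSpace 𝓘(ℝ, E) x)
    (b := fun v : TangentBundle 𝓘(ℝ, E) X => v.1) (v := fun v => v.2) (w := fun v => v.2)
    continuous_id continuous_id

/-- There is a distance inducing the topology of `X` for which the curves of the moduli space
are equi-Lipschitz. -/
theorem HermitianMetric.exists_edist [CompleteSpace E] [RegularSpace X]
    (g : HermitianMetric E X) :
    ∃ d : X → X → ENNReal, (∀ x y z, d x z ≤ d x y + d y z) ∧
      (∀ x, ∀ c > 0, ∀ᶠ y in 𝓝 x, d x y < c) ∧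
      (∀ x, ∀ s ∈ 𝓝 x, ∃ c > 0, ∀ y, d x y < c → y ∈ s) ∧
      ∀ f ∈ g.moduli, ∀ z w, d (f z) (f w) ≤ 4 * edist z w := by
  let : RiemannianBundle (fun x : X => TangentSpace 𝓘(ℝ, E) x) :=
    ⟨g.toContMDiffRiemannianMetric.toRiemannianMetric⟩
  have : IsContinuousRiemannianBundle E (fun x : X => TangentSpace 𝓘(ℝ, E) x) :=
    ⟨g.inner, g.contMDiff.continuous, fun _ _ _ => rfl⟩
  refine ⟨Manifold.riemannianEDist 𝓘(ℝ, E), fun x y z => Manifold.riemannianEDist_triangle,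
    fun x c hc => eventually_riemannianEDist_lt _ _ hc, fun x s hs => ?_, ?_⟩
  · exact setOfPred_riemannianEDist_lt_subset_nhds' 𝓘(ℝ, E) hs
  intro f hf z w
  have hinner : ∀ x (v : TangentSpace 𝓘(ℝ, E) x), ‖v‖ = Real.sqrt (g.inner x v v) := fun x v =>
    norm_eq_sqrt_real_inner v
  have hnorm : ∀ (u v : ℂ), ‖mfderiv 𝓘(ℝ, ℂ) 𝓘(ℝ, E) f u v‖ ≤ 4 * ‖v‖ := by
    intro u v
    have h1 := g.normDf_sq f u
    have h2 : g.normDf f u ^ 2 ≤ 1 := pow_le_one₀ (g.normDf_nonneg f u) (hf.2 u)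
    have h3 := g.inner_self_nonneg (f u) (dfx f u)
    have h4 := g.inner_self_nonneg (f u) (dfy f u)
    -- Half the sum of the squared lengths of the partials is at most 1, so each has length at most
    -- `√2 ≤ 2`; the two together give the constant 4.
    have hx : ‖(dfx f u : TangentSpace 𝓘(ℝ, E) (f u))‖ ≤ 2 := by
      rw [hinner, Real.sqrt_le_left (by norm_num)]
      linarith
    have hy : ‖(dfy f u : TangentSpace 𝓘(ℝ, E) (f u))‖ ≤ 2 := by
      rw [hinner, Real.sqrt_le_left (by norm_num)]
      linarith
    have hv : mfderiv 𝓘(ℝ, ℂ) 𝓘(ℝ, E) f u v = v.re • dfx f u + v.im • dfy f u := by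
      have key (L : ℂ →L[ℝ] TangentSpace 𝓘(ℝ, E) (f u)) :
          L v = v.re • L 1 + v.im • L Complex.I := by
        rw [← map_smul, ← map_smul, ← map_add]
        simp
      exact key (mfderiv 𝓘(ℝ, ℂ) 𝓘(ℝ, E) f u)
    rw [hv]
    refine (norm_add_le _ _).trans ?_
    rw [norm_smul, norm_smul]
    have h5 := mul_le_mul (Complex.abs_re_le_norm v) hx (norm_nonneg _) (norm_nonneg _)
    have h6 := mul_le_mul (Complex.abs_im_le_norm v) hy (norm_nonneg _) (norm_nonneg _)
    rw [Real.norm_eq_abs, Real.norm_eq_abs]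
    linarith
  -- The image under `f` of the segment from `z` to `w` bounds the distance from above by its
  -- length.
  let γ : ℝ → ℂ := fun t => z + t • (w - z)
  have hγ : ContDiff ℝ 1 γ := by unfold γ; fun_prop
  have hγ' : ∀ t, HasDerivAt γ (w - z) t := fun t => by
    have h := ((hasDerivAt_id t).smul_const (w - z)).const_add z
    rwa [one_smul] at h
  have h1 := Manifold.riemannianEDist_le_pathELength (I := 𝓘(ℝ, E)) (γ := f ∘ γ) (a := 0) (b := 1)
    (x := f z) (y := f w) ((contMDiff_real hf.1).comp hγ.contMDiff).contMDiffOn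
    (by simp [γ]) (by simp [γ]) zero_le_one
  refine h1.trans ?_
  rw [Manifold.pathELength_eq_lintegral_mfderiv_Icc]
  have h2 : ∀ t, ‖mfderiv 𝓘(ℝ, ℝ) 𝓘(ℝ, E) (f ∘ γ) t 1‖ₑ ≤ 4 * edist z w := by
    intro t
    have h3 : mfderiv 𝓘(ℝ, ℝ) 𝓘(ℝ, E) (f ∘ γ) t 1 =
        mfderiv 𝓘(ℝ, ℂ) 𝓘(ℝ, E) f (γ t) (w - z) := by
      rw [mfderiv_comp t (mdifferentiableAt_real (hf.1 _))
        (hγ' t).differentiableAt.mdifferentiableAt, mfderiv_eq_fderiv]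
      change mfderiv 𝓘(ℝ, ℂ) 𝓘(ℝ, E) f (γ t) (fderiv ℝ γ t 1) = _
      rw [fderiv_apply_one_eq_deriv, (hγ' t).deriv]
    rw [h3, ← ofReal_norm, edist_comm, edist_eq_enorm_sub, ← ofReal_norm (w - z)]
    rw [show (4 : ENNReal) = ENNReal.ofReal 4 by simp, ← ENNReal.ofReal_mul (by norm_num)]
    exact ENNReal.ofReal_le_ofReal (hnorm _ _)
  calc _ ≤ ∫⁻ _ in Set.Icc (0 : ℝ) 1, 4 * edist z w := lintegral_mono h2
    _ = _ := by simp

end Distance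

/-! ### Limits of holomorphic curves. -/

section Convergence

variable {E : Type*} [NormedAddCommGroup E] [NormedSpace ℂ E]
  {X : Type*} [TopologicalSpace X] [ChartedSpace E X] [IsManifold 𝓘(ℂ, E) ω X]

/-- A limit in the sense of continuous convergence is continuous. -/
theorem continuous_of_tendsto_prod {ι A Y : Type*} [TopologicalSpace A] [TopologicalSpace Y]
    [RegularSpace Y] {l : Filter ι} [l.NeBot] {F : ι → A → Y} {f : A → Y}
    (hF : ∀ z, Tendsto (fun p : ι × A => F p.1 p.2) (l ×ˢ 𝓝 z) (𝓝 (f z))) : Continuous f := by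
  refine continuous_iff_continuousAt.2 fun z => ?_
  refine (closed_nhds_basis (f z)).tendsto_right_iff.2 fun C hC => ?_
  obtain ⟨pa, ha, pb, hb, hab⟩ := eventually_prod_iff.1 ((hF z).eventually hC.1)
  filter_upwards [hb] with w hw
  refine hC.2.mem_of_tendsto
    ((hF w).comp (tendsto_id.prodMk (tendsto_const_nhds (x := w)))) ?_
  filter_upwards [ha] with i hi
  exact hab hi hw

/-- Continuous convergence of holomorphic curves implies holomorphicity of the limit and continuous
convergence of the derivatives. -/
theorem mdifferentiableAt_and_tendsto_mfderiv [CompleteSpace E] [RegularSpace X] {ι : Type*}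
    {l : Filter ι} [l.NeBot] {F : ι → ℂ → X} {f : ℂ → X}
    (hd : ∀ i, MDifferentiable 𝓘(ℂ, ℂ) 𝓘(ℂ, E) (F i))
    (hF : ∀ z, Tendsto (fun p : ι × ℂ => F p.1 p.2) (l ×ˢ 𝓝 z) (𝓝 (f z))) (z : ℂ) :
    MDifferentiableAt 𝓘(ℂ, ℂ) 𝓘(ℂ, E) f z ∧ ∀ v : ℂ,
      Tendsto (fun p : ι × ℂ =>
        (⟨F p.1 p.2, mfderiv 𝓘(ℝ, ℂ) 𝓘(ℝ, E) (F p.1) p.2 v⟩ : TangentBundle 𝓘(ℝ, E) X))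
        (l ×ˢ 𝓝 z) (𝓝 ⟨f z, mfderiv 𝓘(ℝ, ℂ) 𝓘(ℝ, E) f z v⟩) := by
  have hc := continuous_of_tendsto_prod hF
  set φ := extChartAt 𝓘(ℂ, E) (f z) with hφ
  have hs : (chartAt E (f z)).source ∈ 𝓝 (f z) := chart_source_mem_nhds E (f z)
  obtain ⟨pa, ha, pb, hb, hab⟩ := eventually_prod_iff.1 ((hF z).eventually hs)
  obtain ⟨V, hV, hVo, hzV⟩ := eventually_nhds_iff.1
    (hb.and (hc.continuousAt.eventually hs))
  have hG : ∀ i, pa i → DifferentiableOn ℂ (φ ∘ F i) V := fun i hi w hw =>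
    (differentiableAt_extChartAt_comp (hd i w) (hab hi (hV w hw).1)).differentiableWithinAt
  have hG' : ∀ᶠ i in l, DifferentiableOn ℂ (φ ∘ F i) V := ha.mono hG
  have hφc : ∀ w ∈ V, ContinuousAt φ (f w) := fun w hw =>
    continuousAt_extChartAt' (by rw [extChartAt_source]; exact (hV w hw).2)
  -- On the open set `V`, which all the curves eventually map into one chart, continuous convergence
  -- is locally uniform convergence, so Weierstrass's theorem applies.
  have hconv : TendstoLocallyUniformlyOn (fun i => φ ∘ F i) (φ ∘ f) l V := by
    rw [tendstoLocallyUniformlyOn_iff_forall_tendsto]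
    intro w hw
    refine Tendsto.mono_left ?_ (Filter.prod_mono le_rfl nhdsWithin_le_nhds)
    have h1 : Tendsto (fun y : ι × ℂ => φ (F y.1 y.2)) (l ×ˢ 𝓝 w) (𝓝 (φ (f w))) :=
      (hφc w hw).tendsto.comp (hF w)
    have h2 : Tendsto (fun y : ι × ℂ => φ (f y.2)) (l ×ˢ 𝓝 w) (𝓝 (φ (f w))) :=
      ((hφc w hw).tendsto.comp hc.continuousAt).comp tendsto_snd
    exact (h2.prodMk_nhds h1).mono_right (nhds_le_uniformity _)
  have hfd : DifferentiableOn ℂ (φ ∘ f) V := hconv.differentiableOn hG' hVo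
  have hderiv := hconv.deriv hG' hVo
  have hfm : MDifferentiableAt 𝓘(ℂ, ℂ) 𝓘(ℂ, E) f z :=
    (mdifferentiableAt_iff_target_of_mem_source (mem_chart_source E (f z))).2
      ⟨hc.continuousAt, (hfd.differentiableAt (hVo.mem_nhds hzV)).mdifferentiableAt⟩
  refine ⟨hfm, fun v => ?_⟩
  rw [(trivializationAt E (TangentSpace 𝓘(ℝ, E)) (f z)).tendsto_nhds_iff
    (FiberBundle.mem_trivializationAt_proj_source (F := E)
      (x := (⟨f z, mfderiv 𝓘(ℝ, ℂ) 𝓘(ℝ, E) f z v⟩ : TangentBundle 𝓘(ℝ, E) X)))]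
  refine ⟨hF z, ?_⟩
  rw [trivializationAt_mfderiv hfm (mem_chart_source E (f z))]
  have hjoint : Tendsto (fun p : ι × ℂ => deriv (φ ∘ F p.1) p.2) (l ×ˢ 𝓝 z)
      (𝓝 (deriv (φ ∘ f) z)) := by
    have h1 := (tendstoLocallyUniformlyOn_iff_forall_tendsto.1 hderiv) z hzV
    rw [hVo.nhdsWithin_eq hzV] at h1
    have h2 : Tendsto (fun y : ι × ℂ => deriv (φ ∘ f) y.2) (l ×ˢ 𝓝 z) (𝓝 (deriv (φ ∘ f) z)) :=
      (((hfd.deriv hVo).continuousOn.continuousAt (hVo.mem_nhds hzV))).tendsto.comp tendsto_snd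
    exact h2.congr_uniformity h1
  refine (hjoint.const_smul v).congr' ?_
  filter_upwards [(hF z).eventually hs] with p hp
  exact (trivializationAt_mfderiv (hd p.1 p.2) hp v).symm

theorem HermitianMetric.tendsto_normDf [CompleteSpace E] [RegularSpace X]
    (g : HermitianMetric E X) {ι : Type*}
    {l : Filter ι} [l.NeBot] {F : ι → ℂ → X} {f : ℂ → X}
    (hd : ∀ i, MDifferentiable 𝓘(ℂ, ℂ) 𝓘(ℂ, E) (F i))
    (hF : ∀ z, Tendsto (fun p : ι × ℂ => F p.1 p.2) (l ×ˢ 𝓝 z) (𝓝 (f z))) (z : ℂ) :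
    Tendsto (fun p : ι × ℂ => g.normDf (F p.1) p.2) (l ×ˢ 𝓝 z) (𝓝 (g.normDf f z)) := by
  have h := (mdifferentiableAt_and_tendsto_mfderiv hd hF z).2
  have h1 : Tendsto (fun p : ι × ℂ =>
      g.inner (F p.1 p.2) (dfx (F p.1) p.2) (dfx (F p.1) p.2)) (l ×ˢ 𝓝 z)
      (𝓝 (g.inner (f z) (dfx f z) (dfx f z))) :=
    (g.continuous_inner_self.tendsto _).comp (h 1)
  have h2 : Tendsto (fun p : ι × ℂ =>
      g.inner (F p.1 p.2) (dfy (F p.1) p.2) (dfy (F p.1) p.2)) (l ×ˢ 𝓝 z)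
      (𝓝 (g.inner (f z) (dfy f z) (dfy f z))) :=
    (g.continuous_inner_self.tendsto _).comp (h Complex.I)
  simp only [g.normDf_eq_sqrt]
  exact ((h1.add h2).div_const 2).sqrt

theorem HermitianMetric.continuous_normDf [CompleteSpace E] [RegularSpace X]
    (g : HermitianMetric E X) {f : ℂ → X} (hf : MDifferentiable 𝓘(ℂ, ℂ) 𝓘(ℂ, E) f) :
    Continuous (g.normDf f) := by
  refine continuous_iff_continuousAt.2 fun z => ?_
  -- The constant family over `Unit` turns the convergence lemma into continuity of `|df|`.
  have hF : ∀ w, Tendsto (fun p : Unit × ℂ => f p.2) (pure () ×ˢ 𝓝 w) (𝓝 (f w)) := fun w =>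
    (hf.continuous.tendsto w).comp tendsto_snd
  have h : Tendsto (fun p : Unit × ℂ => g.normDf f p.2) (pure () ×ˢ 𝓝 z) (𝓝 (g.normDf f z)) :=
    g.tendsto_normDf (F := fun _ : Unit => f) (fun _ => hf) hF z
  have h' : Tendsto (fun w : ℂ => ((), w)) (𝓝 z) (pure () ×ˢ 𝓝 z) :=
    tendsto_const_pure.prodMk tendsto_id
  exact (Tendsto.comp h h' :)

/-- Compactness of the moduli space, along ultrafilters. -/
theorem HermitianMetric.exists_limit [CompleteSpace E] [T2Space X] [CompactSpace X]
    (g : HermitianMetric E X) {ι : Type*} (l : Ultrafilter ι) {F : ι → ℂ → X}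
    (hM : ∀ i, F i ∈ g.moduli) :
    ∃ f ∈ g.moduli, ∀ z,
      Tendsto (fun p : ι × ℂ => g.normDf (F p.1) p.2) (↑l ×ˢ 𝓝 z) (𝓝 (g.normDf f z)) := by
  obtain ⟨d, htri, hd1, hd2, hlip⟩ := g.exists_edist
  have hlim : ∀ z, ∃ x, Tendsto (fun i => F i z) l (𝓝 x) := fun z => by
    obtain ⟨x, -, hx⟩ := isCompact_univ.ultrafilter_le_nhds (l.map fun i => F i z) (by simp)
    exact ⟨x, hx⟩
  choose f hf using hlim
  -- The common Lipschitz constant upgrades the pointwise limit to continuous convergence.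
  have hF : ∀ z, Tendsto (fun p : ι × ℂ => F p.1 p.2) (↑l ×ˢ 𝓝 z) (𝓝 (f z)) := by
    intro z s hs
    obtain ⟨c, hc, hcs⟩ := hd2 _ s hs
    have hc2 : 0 < c / 2 := ENNReal.half_pos hc.ne'
    have h1 : ∀ᶠ i in l, d (f z) (F i z) < c / 2 := (hf z).eventually (hd1 _ _ hc2)
    have h2 : ∀ᶠ w in 𝓝 z, 4 * edist z w < c / 2 := by
      have : Tendsto (fun w => 4 * edist z w) (𝓝 z) (𝓝 (4 * edist z z)) :=
        ENNReal.Tendsto.const_mul (Continuous.tendsto (by fun_prop) z) (Or.inr (by simp))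
      rw [edist_self, mul_zero] at this
      exact this.eventually (gt_mem_nhds hc2)
    refine mem_map.2 ?_
    filter_upwards [h1.prod_mk h2] with p hp
    refine hcs _ ?_
    calc d (f z) (F p.1 p.2) ≤ d (f z) (F p.1 z) + d (F p.1 z) (F p.1 p.2) := htri _ _ _
      _ < c / 2 + c / 2 := ENNReal.add_lt_add hp.1 ((hlip _ (hM p.1) _ _).trans_lt hp.2)
      _ = c := ENNReal.add_halves c
  have hconv := g.tendsto_normDf (fun i => (hM i).1) hF
  refine ⟨f, ⟨fun z => (mdifferentiableAt_and_tendsto_mfderiv (fun i => (hM i).1) hF z).1,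
    fun z => ?_⟩, hconv⟩
  exact le_of_tendsto (hconv z) (Eventually.of_forall fun p => (hM p.1).2 p.2)

end Convergence

/-! ### From means over small discs to the upper density. -/

section Density

/-- A function on the plane whose mean over every disc of radius `r` is at most `η` has upper
mean density at most `η`. -/
theorem limsup_div_le_of_setLIntegral_ball_le {u : ℂ → ENNReal} (hu : Measurable u) {r η : ℝ}
    (hr : 0 < r) (hη : 0 ≤ η) (h : ∀ a, ∫⁻ z in Metric.ball a r, u z ≤
      ENNReal.ofReal η * volume (Metric.ball (0 : ℂ) r)) :
    limsup (fun R : ℝ => (∫⁻ z in Metric.closedBall (0 : ℂ) R, u z) /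
      ENNReal.ofReal (Real.pi * R ^ 2)) atTop ≤ ENNReal.ofReal η := by
  have hvol : ∀ (a : ℂ) {s : ℝ}, 0 ≤ s →
      volume (Metric.ball a s) = ENNReal.ofReal (Real.pi * s ^ 2) := fun a s hs => by
    rw [Complex.volume_ball, ← ENNReal.ofReal_pow hs, mul_comm Real.pi,
      ENNReal.ofReal_mul (by positivity), ← NNReal.coe_real_pi, ENNReal.ofReal_coe_nnreal]
  have key : ∀ R : ℝ, 0 < R → ∫⁻ z in Metric.closedBall (0 : ℂ) R, u z ≤
      ENNReal.ofReal (η * (Real.pi * (R + r) ^ 2)) := by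
    intro R hR
    have hind : ∀ a z : ℂ, (Metric.ball a r).indicator u z = (Metric.ball z r).indicator 1 a * u z := by
      intro a z
      by_cases haz : z ∈ Metric.ball a r
      · rw [Set.indicator_of_mem haz, Set.indicator_of_mem (Metric.mem_ball_comm.1 haz)]; simp
      · rw [Set.indicator_of_notMem haz,
          Set.indicator_of_notMem (fun h => haz (Metric.mem_ball_comm.1 h))]; simp
    have hmeas : Measurable fun p : ℂ × ℂ => (Metric.ball p.2 r).indicator (1 : ℂ → ENNReal) p.1 := by
      have : MeasurableSet {p : ℂ × ℂ | dist p.1 p.2 < r} :=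
        measurableSet_lt (by fun_prop) (by fun_prop)
      exact (measurable_one (α := ENNReal)).indicator this
    have hR' : volume (Metric.ball (0 : ℂ) r) ≠ 0 := (Metric.measure_ball_pos _ _ hr).ne'
    have hR'' : volume (Metric.ball (0 : ℂ) r) ≠ ⊤ := measure_ball_lt_top.ne
    -- Double counting: the volume of an `r`-ball is the measure of the centres `a` whose ball
    -- contains a given `z`, and for `|z| ≤ R` these all lie in the ball of radius `R + r`.
    refine (ENNReal.mul_le_mul_iff_right hR' hR'').1 ?_
    calc volume (Metric.ball (0 : ℂ) r) * ∫⁻ z in Metric.closedBall (0 : ℂ) R, u z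
        = ∫⁻ z in Metric.closedBall (0 : ℂ) R, volume (Metric.ball (0 : ℂ) r) * u z :=
          (lintegral_const_mul _ hu).symm
      _ ≤ ∫⁻ z in Metric.closedBall (0 : ℂ) R,
            ∫⁻ a in Metric.ball (0 : ℂ) (R + r), (Metric.ball z r).indicator 1 a * u z := by
          refine setLIntegral_mono' Metric.isClosed_closedBall.measurableSet fun z hz => ?_
          rw [lintegral_mul_const _ (measurable_one.indicator measurableSet_ball),
            lintegral_indicator_one measurableSet_ball,
            Measure.restrict_apply measurableSet_ball, Set.inter_eq_left.2, hvol _ hr.le,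
            hvol _ hr.le]
          exact Metric.ball_subset_ball' (by have := Metric.mem_closedBall.1 hz; linarith)
      _ ≤ ∫⁻ z, ∫⁻ a in Metric.ball (0 : ℂ) (R + r), (Metric.ball z r).indicator 1 a * u z :=
          setLIntegral_le_lintegral _ _
      _ = ∫⁻ a in Metric.ball (0 : ℂ) (R + r), ∫⁻ z, (Metric.ball z r).indicator 1 a * u z := by
          refine lintegral_lintegral_swap (Measurable.aemeasurable ?_)
          exact (hmeas.comp measurable_swap).mul (hu.comp measurable_fst)
      _ = ∫⁻ a in Metric.ball (0 : ℂ) (R + r), ∫⁻ z in Metric.ball a r, u z := by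
          simp_rw [← hind, lintegral_indicator measurableSet_ball]
      _ ≤ ∫⁻ _ in Metric.ball (0 : ℂ) (R + r),
            ENNReal.ofReal η * volume (Metric.ball (0 : ℂ) r) := lintegral_mono h
      _ = volume (Metric.ball (0 : ℂ) r) * ENNReal.ofReal (η * (Real.pi * (R + r) ^ 2)) := by
          rw [setLIntegral_const, hvol 0 (by positivity : 0 ≤ R + r), ENNReal.ofReal_mul hη]
          ring
  have hlim : Tendsto (fun R : ℝ => ENNReal.ofReal (η * (1 + r / R) ^ 2)) atTop
      (𝓝 (ENNReal.ofReal η)) := by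
    refine ENNReal.tendsto_ofReal ?_
    have h1 : Tendsto (fun R : ℝ => η * (1 + r / R) ^ 2) atTop (𝓝 (η * (1 + 0) ^ 2)) :=
      (((tendsto_const_nhds.div_atTop tendsto_id).const_add 1).pow 2).const_mul η
    simpa using h1
  rw [← hlim.limsup_eq]
  refine limsup_le_limsup ?_
  filter_upwards [eventually_gt_atTop 0] with R hR
  have hpos : 0 < Real.pi * R ^ 2 := by positivity
  refine (ENNReal.div_le_div_right (key R hR) _).trans_eq ?_
  rw [← ENNReal.ofReal_div_of_pos hpos]
  congr 1
  field_simp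

end Density

/-! ### The uniform gap and its consequence for the density. -/

section Gap

variable {E : Type*} [NormedAddCommGroup E] [NormedSpace ℂ E]
  {X : Type*} [TopologicalSpace X] [ChartedSpace E X] [IsManifold 𝓘(ℂ, E) ω X]

theorem HermitianMetric.normDf_comp_add_left (g : HermitianMetric E X) {f : ℂ → X}
    (hf : MDifferentiable 𝓘(ℂ, ℂ) 𝓘(ℂ, E) f) (a z : ℂ) :
    g.normDf (fun w => f (a + w)) z = g.normDf f (a + z) := by
  have hd : HasFDerivAt (𝕜 := ℝ) (fun w : ℂ => a + w) (ContinuousLinearMap.id ℝ ℂ) z :=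
    (hasFDerivAt_id z).const_add a
  have h1 : mfderiv 𝓘(ℝ, ℂ) 𝓘(ℝ, E) (fun w => f (a + w)) z =
      mfderiv 𝓘(ℝ, ℂ) 𝓘(ℝ, E) f (a + z) := by
    have h2 := mfderiv_comp (I := 𝓘(ℝ, ℂ)) (I' := 𝓘(ℝ, ℂ)) (I'' := 𝓘(ℝ, E)) z
      (f := fun w : ℂ => a + w) (g := f) (mdifferentiableAt_real (hf (a + z)))
      hd.differentiableAt.mdifferentiableAt
    rw [mfderiv_eq_fderiv, hd.fderiv] at h2
    exact h2
  simp only [HermitianMetric.normDf, dfx, dfy, h1]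
  rfl

theorem HermitianMetric.comp_add_left_mem_moduli (g : HermitianMetric E X) {f : ℂ → X}
    (hf : f ∈ g.moduli) (a : ℂ) : (fun w => f (a + w)) ∈ g.moduli := by
  refine ⟨?_, fun z => ?_⟩
  · have h : Differentiable ℂ fun w : ℂ => a + w := by fun_prop
    exact hf.1.comp h.mdifferentiable
  · rw [g.normDf_comp_add_left hf.1]
    exact hf.2 _

/-- Where `|df| ≤ c`, also `|df|² ≤ |df| ≤ c` because `|df| ≤ 1`; elsewhere `|df|² ≤ 1`. A small
disc of slow speed thus costs a definite amount of energy. -/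
theorem HermitianMetric.setLIntegral_ball_le [CompleteSpace E] [RegularSpace X]
    (g : HermitianMetric E X) {f : ℂ → X} (hf : f ∈ g.moduli) {r ε c : ℝ} {z₀ : ℂ}
    (hsub : Metric.ball z₀ ε ⊆ Metric.ball 0 r) (hc0 : 0 ≤ c)
    (hc : ∀ z ∈ Metric.ball z₀ ε, g.normDf f z ≤ c) :
    ∫⁻ z in Metric.ball (0 : ℂ) r, ENNReal.ofReal (g.normDf f z ^ 2) ≤
      ENNReal.ofReal (volume.real (Metric.ball (0 : ℂ) r) -
        (1 - c) * volume.real (Metric.ball z₀ ε)) := by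
  have h1 : ∫⁻ z in Metric.ball z₀ ε, ENNReal.ofReal (g.normDf f z ^ 2) ≤
      ENNReal.ofReal (c * volume.real (Metric.ball z₀ ε)) := by
    rw [ENNReal.ofReal_mul hc0, ofReal_measureReal (measure_ball_lt_top.ne), ← setLIntegral_const]
    refine setLIntegral_mono' measurableSet_ball fun z hz => ENNReal.ofReal_le_ofReal ?_
    have := g.normDf_nonneg f z
    nlinarith [hc z hz, hf.2 z]
  have h2 : ∫⁻ z in Metric.ball (0 : ℂ) r \ Metric.ball z₀ ε, ENNReal.ofReal (g.normDf f z ^ 2) ≤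
      ENNReal.ofReal (volume.real (Metric.ball (0 : ℂ) r) - volume.real (Metric.ball z₀ ε)) := by
    rw [← measureReal_sdiff hsub measurableSet_ball, ofReal_measureReal
      (measure_ne_top_of_subset Set.sdiff_subset measure_ball_lt_top.ne), ← setLIntegral_one]
    refine lintegral_mono fun z => ?_
    rw [ENNReal.ofReal_le_one]
    exact pow_le_one₀ (g.normDf_nonneg f z) (hf.2 z)
  rw [← Set.union_sdiff_cancel hsub, lintegral_union (measurableSet_ball.diff measurableSet_ball)
    Set.disjoint_sdiff_right, Set.union_sdiff_cancel hsub]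
  refine (add_le_add h1 h2).trans_eq ?_
  rw [← ENNReal.ofReal_add (mul_nonneg hc0 measureReal_nonneg)
    (sub_nonneg.2 (measureReal_mono hsub measure_ball_lt_top.ne))]
  congr 1
  ring

/-- In a manifold without flat discs of radius `r`, the mean of `|df|²` over discs of radius `r`
is bounded away from `1`, uniformly in `f`. -/
theorem HermitianMetric.exists_gap [CompleteSpace E] [T2Space X] [CompactSpace X]
    (g : HermitianMetric E X) {r : ℝ} (hX : g.IsWFL r) :
    ∃ η : ℝ, 0 ≤ η ∧ η < 1 ∧ ∀ f ∈ g.moduli,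
      ∫⁻ z in Metric.ball (0 : ℂ) r, ENNReal.ofReal (g.normDf f z ^ 2) ≤
        ENNReal.ofReal η * volume (Metric.ball (0 : ℂ) r) := by
  by_contra! hcon
  have hη : ∀ n : ℕ, 0 ≤ 1 - 1 / ((n : ℝ) + 1) ∧ 1 - 1 / ((n : ℝ) + 1) < 1 := fun n =>
    ⟨sub_nonneg.2 (by rw [div_le_one (by positivity)]; linarith [n.cast_nonneg (α := ℝ)]),
      sub_lt_self _ (by positivity)⟩
  choose F hM hF using fun n : ℕ => hcon _ (hη n).1 (hη n).2
  -- The ultrafilter is nonprincipal, so the defects `1 / (n + 1)` still tend to 0 along it.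
  obtain ⟨f, hf, hconv⟩ := g.exists_limit (hyperfilter ℕ) hM
  obtain ⟨z₀, hz₀, hne⟩ : ∃ z ∈ Metric.ball (0 : ℂ) r, g.normDf f z ≠ 1 := by
    by_contra! h
    exact hX ⟨f, hf.1.mdifferentiableOn, h⟩
  obtain ⟨c, hfc, hc⟩ := exists_between (lt_of_le_of_ne (hf.2 z₀) hne)
  have hc0 : 0 ≤ c := (g.normDf_nonneg f z₀).trans hfc.le
  obtain ⟨pa, ha, pb, hb, hab⟩ :=
    eventually_prod_iff.1 ((hconv z₀).eventually (gt_mem_nhds hfc))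
  obtain ⟨ε, hε, hεs⟩ := Metric.mem_nhds_iff.1
    (inter_mem hb (Metric.isOpen_ball.mem_nhds hz₀))
  have he : 0 < volume.real (Metric.ball z₀ ε) :=
    ENNReal.toReal_pos (Metric.measure_ball_pos _ _ hε).ne' measure_ball_lt_top.ne
  have hsmall : ∀ᶠ n : ℕ in (hyperfilter ℕ : Filter ℕ),
      1 / ((n : ℝ) + 1) * volume.real (Metric.ball (0 : ℂ) r) <
        (1 - c) * volume.real (Metric.ball z₀ ε) := by
    have h1 := (tendsto_one_div_add_atTop_nhds_zero_nat (𝕜 := ℝ)).mul_const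
      (volume.real (Metric.ball (0 : ℂ) r))
    rw [zero_mul] at h1
    exact Nat.hyperfilter_le_atTop (h1.eventually (gt_mem_nhds (mul_pos (sub_pos.2 hc) he)))
  -- For such an `n` the energy lost on the disc about `z₀` exceeds the defect that the choice of `F
  -- n` allows.
  obtain ⟨n, hna, hns⟩ := (ha.and hsmall).exists
  have h1 := g.setLIntegral_ball_le (hM n) (fun z hz => (hεs hz).2) hc0
    fun z hz => (hab hna (hεs hz).1).le
  have h2 := (hF n).trans_le h1
  rw [← ofReal_measureReal (s := Metric.ball (0 : ℂ) r) measure_ball_lt_top.ne,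
    ← ENNReal.ofReal_mul (hη n).1] at h2
  have h3 := (ENNReal.ofReal_lt_ofReal_iff'.1 h2).1
  linarith

theorem HermitianMetric.packingDensity_le [CompleteSpace E] [RegularSpace X]
    (g : HermitianMetric E X) {r η : ℝ} (hr : 0 < r) (hη : 0 ≤ η)
    (h : ∀ f ∈ g.moduli, ∫⁻ z in Metric.ball (0 : ℂ) r, ENNReal.ofReal (g.normDf f z ^ 2) ≤
        ENNReal.ofReal η * volume (Metric.ball (0 : ℂ) r)) {f : ℂ → X} (hf : f ∈ g.moduli) :
    g.packingDensity f ≤ ENNReal.ofReal η := by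
  refine limsup_div_le_of_setLIntegral_ball_le
    (((g.continuous_normDf hf.1).pow 2).measurable.ennreal_ofReal) hr hη fun a => ?_
  refine le_trans (le_of_eq ?_) (h _ (g.comp_add_left_mem_moduli hf a))
  simp only [g.normDf_comp_add_left hf.1]
  rw [← (measurePreserving_add_left volume a).setLIntegral_comp_preimage_emb
    (measurableEmbedding_addLeft a)]
  simp

end Gap

end HolomorphicPacking

theorem mainTheorem8 {E : Type*} [NormedAddCommGroup E] [NormedSpace ℂ E] [FiniteDimensional ℂ E]
    {X : Type*} [TopologicalSpace X] [ChartedSpace E X] [IsManifold 𝓘(ℂ, E) ω X]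
    [T2Space X] [CompactSpace X] (g : HolomorphicPacking.HermitianMetric E X)
    (r : ℝ) (hr : 0 < r) (hX : g.IsWFL r) :
    g.holomorphicCapacity < 1 := by
  have : CompleteSpace E := FiniteDimensional.complete ℂ E
  obtain ⟨η, hη, hη1, h⟩ := g.exists_gap hX
  calc g.holomorphicCapacity ≤ ENNReal.ofReal η :=
        iSup₂_le fun f hf => g.packingDensity_le hr hη h hf
    _ < 1 := ENNReal.ofReal_lt_one.2 hη1
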